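/- For an integer $q\ge 2$ let $\mathbb T_q$ be the homogeneous tree in which every vertex has degree $q+1$, with a chosen end $\omega$ and a chosen origin $o$ (the choice is immaterial up to isomorphism). The predecessor $x^-$ of a vertex $x$ is its neighbour on the geodesic ray from $x$ to $\omega$, and the Busemann function is $\mathfrak h(x)=d(x,x\curlywedge o)-d(o,x\curlywedge o)$, where $d$ is the graph distance and $x\curlywedge o$ is the first common vertex of the geodesic rays from $x$ and from $o$ to $\omega$. For integers $q_1,\dots,q_d\ge 2$ let $\mathrm{DL}(q_1,\dots,q_d)$ be the graph with vertex set $$\{x_1\cdots x_d\in \mathbb T_{q_1}\times\cdots\times\mathbb T_{q_d} : \mathfrak h(x_1)+\cdots+\mathfrak h(x_d)=0\},$$ in which $x_1\cdots x_d\sim y_1\cdots y_d$ if and only if there are $i\ne j$ with $x_i\sim y_i$, $x_j\sim y_j$, and $x_k=y_k$ for all $k\ne i,j$. Its automorphism group $\mathrm{Aut}(\mathrm{DL}(q_1,\dots,q_d))$ carries the topology of pointwise convergence. A co-compact lattice in a topological group $A$ is a discrete, countable subgroup $\Gamma$ such that the factor space $A/\Gamma$ is compact. **Corollary 2.8.**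 Let $q_1,\dots,q_d\ge 2$ be integers that are not all equal. Then $\mathrm{Aut}(\mathrm{DL}(q_1,\dots,q_d))$ has no co-compact lattice. Moreover, $\mathrm{DL}(q_1,\dots,q_d)$ is vertex-transitive (its automorphism group acts transitively on the vertices), but it is not isomorphic to the Cayley graph of any finitely generated group: there are no group $G$ and finite generating set $S=S^{-1}\subset G$ such that $\mathrm{DL}(q_1,\dots,q_d)$ is isomorphic to the graph with vertex set $G$ in which distinct $x,y\in G$ are neighbours if and only if $x^{-1}y\in S$. -/

import Mathlib

/-! ### Homogeneous trees with a distinguished end -/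

/-- The vertices of the homogeneous tree `𝕋_q` (all degrees `q + 1`) with a distinguished end `ω`,
described by the usual edge labelling: the edges from a vertex to its `q` successors carry distinct
labels in `ℤ/qℤ`, and only finitely many labels on the geodesic from a vertex to `ω` are nonzero.
A vertex in the horocycle `H_n` is given by `n` and the sequence of labels `(a_k)_{k < n}` read
along the geodesic coming from `ω` (`a_k` is the label of the edge between `H_k` and `H_{k+1}`);
the sequence is extended by `0` to all of `ℤ`. -/
@[ext]
structure HomTree (q : ℕ) where
  /-- the index of the horocycle that contains the vertex -/
  level : ℤ
  /-- the edge labels between `ω` and the vertex -/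
  label : ℤ → ZMod q
  label_eq_zero : ∀ k, level ≤ k → label k = 0
  finite_support : ∃ m, ∀ k, k < m → label k = 0

namespace HomTree

variable {q : ℕ}

/-- The predecessor `x⁻` of a vertex: its neighbour in the direction of the end `ω`. -/
def pred (x : HomTree q) : HomTree q where
  level := x.level - 1
  label k := if k < x.level - 1 then x.label k else 0
  label_eq_zero k hk := if_neg (not_lt.mpr hk)
  finite_support := by
    obtain ⟨m, hm⟩ := x.finite_support
    exact ⟨m, fun k hk => by simp [hm k hk]⟩

/-- The successor of a vertex along the edge with label `a`. -/
def succ (x : HomTree q) (a : ZMod q) : HomTree q where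
  level := x.level + 1
  label k := if k = x.level then a else x.label k
  label_eq_zero k hk := by
    rw [if_neg (by omega)]
    exact x.label_eq_zero k (by omega)
  finite_support := by
    obtain ⟨m, hm⟩ := x.finite_support
    refine ⟨min m x.level, fun k hk => ?_⟩
    rw [if_neg (by omega)]
    exact hm k (by omega)

variable (q) in
/-- The origin (root) of the tree. -/
def origin : HomTree q where
  level := 0
  label _ := 0
  label_eq_zero _ _ := rfl
  finite_support := ⟨0, fun _ _ => rfl⟩

variable (q) in
/-- The tree `𝕋_q`: the edges join each vertex with its predecessor. -/
def graph : SimpleGraph (HomTree q) where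
  Adj x y := y = x.pred ∨ x = y.pred
  symm := ⟨fun _ _ h => h.symm⟩
  loopless := ⟨fun x h => by
    have h' : x.level = x.level - 1 := congrArg level (h.elim id id)
    omega⟩

/-- The Busemann function of `𝕋_q` with respect to `ω` and the origin; see `hor_eq_dist`. -/
def hor (x : HomTree q) : ℤ := x.level

/-- The ancestor relation `x ≼ y`: the vertex `x` lies on the geodesic ray `y, y⁻, (y⁻)⁻, …`
from `y` to `ω`. -/
def IsAncestor (x y : HomTree q) : Prop := ∃ n : ℕ, pred^[n] y = x

/-! The following facts confirm that this is the homogeneous tree and its Busemann function. -/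

lemma level_pred (x : HomTree q) : x.pred.level = x.level - 1 := rfl

lemma level_iterate (n : ℕ) (x : HomTree q) : (pred^[n] x).level = x.level - n := by
  induction n generalizing x with
  | zero => simp
  | succ n ih => rw [Function.iterate_succ_apply, ih, level_pred]; push_cast; ring

lemma label_iterate (n : ℕ) (x : HomTree q) (k : ℤ) :
    (pred^[n] x).label k = if k < x.level - n then x.label k else 0 := by
  induction n generalizing x with
  | zero =>
    by_cases h : k < x.level
    · simp [h]
    · simp [h, x.label_eq_zero k (not_lt.mp h)]
  | succ n ih =>
    rw [Function.iterate_succ_apply, ih, level_pred]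
    simp only [pred]
    push_cast
    split_ifs <;> first | rfl | omega

lemma pred_succ (x : HomTree q) (a : ZMod q) : (x.succ a).pred = x := by
  ext k
  · simp [pred, succ]
  · simp only [pred, succ, add_sub_cancel_right]
    split_ifs with h1 h2
    · omega
    · rfl
    · exact (x.label_eq_zero k (not_lt.mp h1)).symm

lemma succ_pred (x : HomTree q) : x.pred.succ (x.label (x.level - 1)) = x := by
  ext k
  · simp [pred, succ]
  · by_cases h1 : k = x.level - 1
    · simp [pred, succ, h1]
    · by_cases h2 : k < x.level - 1
      · simp [pred, succ, h1, h2]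
      · simp [pred, succ, h1, h2, x.label_eq_zero k (by omega)]

lemma succ_injective (x : HomTree q) : Function.Injective x.succ := by
  intro a b h
  have := congrFun (congrArg label h) x.level
  simpa [succ] using this

lemma exists_common_ancestor (x y : HomTree q) : ∃ m n : ℕ, pred^[m] x = pred^[n] y := by
  obtain ⟨a, ha⟩ := x.finite_support
  obtain ⟨b, hb⟩ := y.finite_support
  obtain ⟨c, hca, hcb, hcx, hcy⟩ : ∃ c : ℤ, c ≤ a ∧ c ≤ b ∧ c ≤ x.level ∧ c ≤ y.level :=
    ⟨min (min a b) (min x.level y.level), by omega, by omega, by omega, by omega⟩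
  refine ⟨(x.level - c).toNat, (y.level - c).toNat, ?_⟩
  ext k
  · rw [level_iterate, level_iterate]; omega
  · rw [label_iterate, label_iterate]
    have h1 : x.level - ((x.level - c).toNat : ℤ) = c := by omega
    have h2 : y.level - ((y.level - c).toNat : ℤ) = c := by omega
    rw [h1, h2]
    split_ifs with h
    · rw [ha k (by omega), hb k (by omega)]
    · rfl

lemma exists_walk_iterate (n : ℕ) (x : HomTree q) :
    ∃ w : (graph q).Walk x (pred^[n] x), w.length = n := by
  induction n generalizing x with
  | zero => exact ⟨.nil, rfl⟩
  | succ n ih =>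
    obtain ⟨w, hw⟩ := ih x.pred
    exact ⟨.cons (Or.inl rfl) w, congrArg (· + 1) hw⟩

lemma level_sub_le_length {x y : HomTree q} (w : (graph q).Walk x y) :
    x.level - y.level ≤ w.length := by
  induction w with
  | nil => simp
  | cons h w ih =>
    rw [SimpleGraph.Walk.length_cons]
    push_cast
    rcases h with h | h
    · have := congrArg level h
      rw [level_pred] at this
      omega
    · have := congrArg level h
      rw [level_pred] at this
      omega

lemma dist_iterate (n : ℕ) (x : HomTree q) : (graph q).dist x (pred^[n] x) = n := by
  obtain ⟨w, hw⟩ := exists_walk_iterate n x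
  refine le_antisymm ((SimpleGraph.dist_le w).trans_eq hw) ?_
  obtain ⟨v, hv⟩ := w.reachable.exists_walk_length_eq_dist
  have := level_sub_le_length v
  rw [hv, level_iterate] at this
  omega

/-- The Busemann function: `𝔥(x) = d(x, x ⋏ o) - d(o, x ⋏ o)`, where `x ⋏ o` is the maximal common
ancestor of `x` and the origin `o`. -/
theorem hor_eq_dist (x : HomTree q) : ∃ c : HomTree q,
    IsAncestor c x ∧ IsAncestor c (origin q) ∧
    (∀ c', IsAncestor c' x → IsAncestor c' (origin q) → IsAncestor c' c) ∧
    x.hor = (graph q).dist x c - (graph q).dist (origin q) c := by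
  classical
  have hex : ∃ m, IsAncestor (pred^[m] x) (origin q) := by
    obtain ⟨m, n, h⟩ := exists_common_ancestor x (origin q)
    exact ⟨m, n, h.symm⟩
  obtain ⟨n, hn⟩ := Nat.find_spec hex
  refine ⟨pred^[Nat.find hex] x, ⟨_, rfl⟩, ⟨n, hn⟩, ?_, ?_⟩
  · rintro c' ⟨m, rfl⟩ hm
    refine ⟨m - Nat.find hex, ?_⟩
    rw [← Function.iterate_add_apply, Nat.sub_add_cancel (Nat.find_min' hex hm)]
  · rw [dist_iterate]
    conv_rhs => rw [← hn, dist_iterate]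
    have := congrArg level hn
    rw [level_iterate, level_iterate] at this
    simp only [hor, origin] at this ⊢
    omega

theorem graph_isTree : (graph q).IsTree where
  connected := by
    have : Nonempty (HomTree q) := ⟨origin q⟩
    refine ⟨fun x y => ?_⟩
    obtain ⟨m, n, h⟩ := exists_common_ancestor x y
    obtain ⟨w, -⟩ := exists_walk_iterate m x
    obtain ⟨v, -⟩ := exists_walk_iterate n y
    exact w.reachable.trans (h ▸ v.reachable.symm)
  isAcyclic := by
    rw [SimpleGraph.isAcyclic_iff_forall_adj_isBridge]
    have key : ∀ x : HomTree q, (graph q).IsBridge s(x, x.pred) := by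
      intro x
      rw [SimpleGraph.isBridge_iff]
      rintro ⟨w⟩
      have inv : ∀ {u v : HomTree q}, ((graph q).deleteEdges {s(x, x.pred)}).Walk u v →
          IsAncestor x u → IsAncestor x v := by
        intro u v w
        induction w with
        | nil => exact id
        | @cons a b c h w ih =>
          rintro ⟨n, hn⟩
          apply ih
          rw [SimpleGraph.deleteEdges_adj] at h
          obtain ⟨h | h, hne⟩ := h
          · cases n with
            | zero =>
              exfalso
              apply hne
              simp only [Function.iterate_zero, id_eq] at hn
              subst hn
              rw [h]
              rfl
            | succ n => exact ⟨n, by rw [h, ← Function.iterate_succ_apply, hn]⟩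
          · exact ⟨n + 1, by rw [Function.iterate_succ_apply, ← h, hn]⟩
      obtain ⟨n, hn⟩ := inv w ⟨0, rfl⟩
      have := congrArg level hn
      rw [level_iterate, level_pred] at this
      omega
    rintro x y (h | h)
    · exact h ▸ key x
    · rw [Sym2.eq_swap]
      exact h ▸ key y

/-- Every vertex of `𝕋_q` has degree `q + 1`. -/
theorem ncard_neighborSet [NeZero q] (x : HomTree q) :
    ((graph q).neighborSet x).ncard = q + 1 := by
  have h : (graph q).neighborSet x = insert x.pred (Set.range x.succ) := by
    ext y
    simp only [SimpleGraph.mem_neighborSet, graph, Set.mem_insert_iff, Set.mem_range]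
    refine or_congr Iff.rfl ⟨fun h => ⟨_, h ▸ succ_pred y⟩, ?_⟩
    rintro ⟨a, rfl⟩
    exact (pred_succ x a).symm
  rw [h, Set.ncard_insert_of_notMem _ (Set.finite_range _), ← Set.image_univ,
    Set.ncard_image_of_injective _ x.succ_injective, Set.ncard_univ, Nat.card_zmod]
  rintro ⟨a, ha⟩
  have := congrArg level ha
  simp only [succ, pred] at this
  omega

end HomTree

/-! ### Horocyclic products and Diestel–Leader graphs -/

/-- The vertex set of the horocyclic product of graphs `X j` with Busemann functions `hor j`. -/
def HorocyclicVertex {ι : Type*} [Fintype ι] (X : ι → Type*) (hor : ∀ j, X j → ℤ) : Type _ :=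
  {x : ∀ j, X j // ∑ j, hor j (x j) = 0}

/-- The horocyclic product: `x` and `y` are neighbours when there are `i ≠ j` such that `x i ∼ y i`,
`x j ∼ y j` and `x k = y k` for all other `k`. -/
def horocyclicProduct {ι : Type*} [Fintype ι] {X : ι → Type*} (G : ∀ j, SimpleGraph (X j))
    (hor : ∀ j, X j → ℤ) : SimpleGraph (HorocyclicVertex X hor) where
  Adj x y := ∃ i j, i ≠ j ∧ (G i).Adj (x.1 i) (y.1 i) ∧ (G j).Adj (x.1 j) (y.1 j) ∧
    ∀ k, k ≠ i → k ≠ j → x.1 k = y.1 k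
  symm := ⟨by
    rintro x y ⟨i, j, hij, hi, hj, h⟩
    exact ⟨i, j, hij, hi.symm, hj.symm, fun k hki hkj => (h k hki hkj).symm⟩⟩
  loopless := ⟨by
    rintro x ⟨i, _, _, hi, _⟩
    exact (G i).loopless.irrefl _ hi⟩

/-- The Diestel–Leader graph `DL(q_1, …, q_d)`. -/
def diestelLeader {d : ℕ} (q : Fin d → ℕ) :
    SimpleGraph (HorocyclicVertex (fun j => HomTree (q j)) (fun _ => HomTree.hor)) :=
  horocyclicProduct (fun j => HomTree.graph (q j)) (fun _ => HomTree.hor)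

/-! ### Automorphism groups and lattices -/

/-- A graph is vertex-transitive if its automorphism group acts transitively on the vertices. -/
def IsVertexTransitive {V : Type*} (G : SimpleGraph V) : Prop :=
  ∀ x y : V, ∃ g : G ≃g G, g x = y

/-- The topology of pointwise convergence on the automorphism group of a graph (whose vertex set is
discrete). -/
instance autTopology {V : Type*} (G : SimpleGraph V) : TopologicalSpace (G ≃g G) :=
  TopologicalSpace.induced (fun (g : G ≃g G) (v : V) => g v)
    (@Pi.topologicalSpace V (fun _ => V) (fun _ => ⊥))

lemma isOpen_setOf_aut_apply_eq {V : Type*} (G : SimpleGraph V) (v w : V) :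
    IsOpen {g : G ≃g G | g v = w} := by
  let _ : TopologicalSpace V := ⊥
  have : DiscreteTopology V := ⟨rfl⟩
  have h : Continuous fun g : G ≃g G => g v := (continuous_apply v).comp continuous_induced_dom
  exact (isOpen_discrete {w}).preimage h

instance isTopologicalGroup_aut {V : Type*} (G : SimpleGraph V) :
    IsTopologicalGroup (G ≃g G) where
  continuous_mul := by
    let _ : TopologicalSpace V := ⊥
    have : DiscreteTopology V := ⟨rfl⟩
    refine continuous_induced_rng.mpr (continuous_pi fun v => continuous_discrete_rng.mpr ?_)
    intro w
    have h : (fun p : (G ≃g G) × (G ≃g G) => (p.1 * p.2) v) ⁻¹' {w} =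
        ⋃ u, {g : G ≃g G | g u = w} ×ˢ {g : G ≃g G | g v = u} := by
      ext p
      simp [RelIso.mul_apply]
    exact h ▸ isOpen_iUnion fun u =>
      (isOpen_setOf_aut_apply_eq G u w).prod (isOpen_setOf_aut_apply_eq G v u)
  continuous_inv := by
    let _ : TopologicalSpace V := ⊥
    have : DiscreteTopology V := ⟨rfl⟩
    refine continuous_induced_rng.mpr (continuous_pi fun v => continuous_discrete_rng.mpr ?_)
    intro w
    have h : (fun g : G ≃g G => g⁻¹ v) ⁻¹' {w} = {g : G ≃g G | g w = v} := by
      ext g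
      simp only [Set.mem_preimage, Set.mem_singleton_iff, Set.mem_ofPred_eq]
      constructor
      · rintro rfl
        exact RelIso.apply_inv_self g v
      · rintro rfl
        exact RelIso.inv_apply_self g w
    exact h ▸ isOpen_setOf_aut_apply_eq G w v

/-- A co-compact lattice: a discrete, countable subgroup such that the factor space is compact. -/
structure IsCocompactLattice {A : Type*} [Group A] [TopologicalSpace A] (Γ : Subgroup A) :
    Prop where
  discrete : DiscreteTopology Γ
  countable : Countable Γ
  cocompact : CompactSpace (A ⧸ Γ)

/-! The obstruction is an automorphism-invariant relation `R` on the vertices whose constant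
out-degree differs from its constant in-degree. An edge moves one coordinate `i` to its predecessor
and another coordinate `j` to one of `q j` successors; traversed backwards it offers `q i` choices
instead. These two numbers can be read off the bare graph. Vertices that differ by the choice of one
successor (`SiblingAt`) are exactly the pairs of non-adjacent vertices with at least `2 * (d - 1)`
common neighbours (`isTwin_iff`), so counting twins recovers `q j` from the directed edge
(`Step.twinCount_eq`). Fix `i`, `j` with `q i ≠ q j` and let `R` consist of the directed edges with
forward number `q j` and backward number `q i`. By `card_adj_twinCount` its out- and in-degree are a
common positive factor times `q j` and `q i`. A co-compact lattice would have finitely many orbits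
and finite stabilizers, and mass transport (`card_out_eq_card_in`) would then equate the two
degrees. In a Cayley graph, inversion in the group equates them (`isEmpty_iso_mulCayley`). -/

section MassTransport

/-! ### Mass transport over finitely many orbits. -/

open MulAction

/-- The fibres of `γ ↦ γ • r` over the orbit are cosets of the stabilizer. Counting group elements
in place of vertices is what makes the exchange of source and target symmetric. -/
lemma card_smul_eq_card_orbit_mul_card_stabilizer {Γ V : Type*} [Group Γ] [MulAction Γ V]
    (p : V → Prop) (r : V) :
    Nat.card {γ : Γ // p (γ • r)} =
      Nat.card {y : orbit Γ r // p y} * Nat.card (stabilizer Γ r) := by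
  rw [← Nat.card_prod]
  refine Nat.card_congr ((Equiv.subtypeEquiv (orbitProdStabilizerEquivGroup Γ r).symm ?_).trans
    (Equiv.prodSubtypeFstEquivSubtypeProd (p := fun y : orbit Γ r => p y)))
  intro γ
  exact Iff.rfl

lemma card_eq_sum_orbits {Γ V : Type*} [Group Γ] [MulAction Γ V]
    [Fintype (orbitRel.Quotient Γ V)] (p : V → Prop) (hp : {y | p y}.Finite) :
    Nat.card {y // p y} =
      ∑ ω : orbitRel.Quotient Γ V, Nat.card {y : orbit Γ ω.out // p y} := by
  have hfin (ω : orbitRel.Quotient Γ V) : Finite {y : orbit Γ ω.out // p y} :=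
    have := hp.to_subtype
    Finite.of_injective (fun y => (⟨y.1.1, y.2⟩ : {y | p y})) fun y z h =>
      Subtype.ext (Subtype.ext (congrArg (fun u => u.1) h))
  rw [← Nat.card_sigma]
  refine Nat.card_congr ((Equiv.subtypeEquiv (selfEquivSigmaOrbits Γ V)
    (q := fun s => p s.2) ?_).trans ?_)
  · intro y
    exact Iff.rfl
  · exact
      { toFun s := ⟨s.1.1, s.1.2, s.2⟩
        invFun s := ⟨⟨s.1, s.2.1⟩, s.2.2⟩
        left_inv _ := rfl
        right_inv _ := rfl }

/-- The mass transport principle for a group that acts with finitely many orbits and finite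
stabilizers. -/
theorem card_out_eq_card_in {Γ V : Type*} [Group Γ] [MulAction Γ V] [Nonempty V]
    [Finite (orbitRel.Quotient Γ V)] (hstab : ∀ v : V, Finite (stabilizer Γ v))
    (R : V → V → Prop) (hR : ∀ (γ : Γ) x y, R x y → R (γ • x) (γ • y))
    (hout : ∀ x, {y | R x y}.Finite) (hin : ∀ x, {y | R y x}.Finite) {a b : ℕ}
    (ha : ∀ x, Nat.card {y // R x y} = a) (hb : ∀ x, Nat.card {y // R y x} = b) : a = b := by
  have := Fintype.ofFinite (orbitRel.Quotient Γ V)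
  set w : orbitRel.Quotient Γ V → ℚ := fun ω => Nat.card (stabilizer Γ ω.out) with hw
  have hwpos (ω) : 0 < w ω := by
    have := hstab ω.out
    exact Nat.cast_pos.mpr Nat.card_pos
  have key (p : V → Prop) (hp : {y | p y}.Finite) : (Nat.card {y // p y} : ℚ) =
      ∑ ω : orbitRel.Quotient Γ V, (Nat.card {γ : Γ // p (γ • ω.out)} : ℚ) / w ω := by
    rw [card_eq_sum_orbits (Γ := Γ) p hp, Nat.cast_sum]
    refine Finset.sum_congr rfl fun ω _ => ?_
    rw [card_smul_eq_card_orbit_mul_card_stabilizer, Nat.cast_mul, eq_div_iff (hwpos ω).ne']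
  -- Applying `γ⁻¹` to both ends moves the translate from the target to the source, and inversion is
  -- a bijection of `Γ`.
  have hsymm (ω ω' : orbitRel.Quotient Γ V) :
      Nat.card {γ : Γ // R ω.out (γ • ω'.out)} = Nat.card {γ : Γ // R (γ • ω.out) ω'.out} := by
    refine Nat.card_congr (Equiv.subtypeEquiv (Equiv.inv Γ) fun γ => ⟨fun h => ?_, fun h => ?_⟩)
    · simpa using hR γ⁻¹ _ _ h
    · simpa using hR γ _ _ h
  -- Each orbit gets mass `1 / w ω`; both sides are the total mass transported between all pairs of
  -- orbits.
  have hsum : ∑ ω, (a : ℚ) / w ω = ∑ ω, (b : ℚ) / w ω := by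
    calc ∑ ω, (a : ℚ) / w ω
        = ∑ ω, ∑ ω', (Nat.card {γ : Γ // R ω.out (γ • ω'.out)} : ℚ) / w ω' / w ω := by
          refine Finset.sum_congr rfl fun ω _ => ?_
          rw [← ha ω.out, key _ (hout _), Finset.sum_div]
      _ = ∑ ω', ∑ ω, (Nat.card {γ : Γ // R (γ • ω.out) ω'.out} : ℚ) / w ω / w ω' := by
          rw [Finset.sum_comm]
          refine Finset.sum_congr rfl fun ω _ => Finset.sum_congr rfl fun ω' _ => ?_
          rw [hsymm, div_right_comm]
      _ = ∑ ω, (b : ℚ) / w ω := by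
          refine Finset.sum_congr rfl fun ω _ => ?_
          rw [← hb ω.out, key (fun y => R y ω.out) (hin _), Finset.sum_div]
  have hpos : 0 < ∑ ω, 1 / w ω :=
    Finset.sum_pos (fun ω _ => one_div_pos.mpr (hwpos ω))
      ⟨Quotient.mk'' (Classical.arbitrary V), Finset.mem_univ _⟩
  have hfactor (c : ℚ) : ∑ ω, c / w ω = c * ∑ ω, 1 / w ω := by
    rw [Finset.mul_sum]
    exact Finset.sum_congr rfl fun ω _ => div_eq_mul_one_div _ _
  rw [hfactor a, hfactor b] at hsum
  exact_mod_cast mul_right_cancel₀ hpos.ne' hsum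

end MassTransport

/-! ### Lattices and Cayley graphs against an unbalanced invariant relation. -/

section Lattice

open MulAction

variable {V : Type*} {G : SimpleGraph V}

lemma finite_setOf_walk (hG : ∀ v, (G.neighborSet v).Finite) (n : ℕ) (v : V) :
    {w | ∃ p : G.Walk v w, p.length = n}.Finite := by
  induction n generalizing v with
  | zero =>
    refine (Set.finite_singleton v).subset ?_
    rintro w ⟨p, hp⟩
    exact (p.eq_of_length_eq_zero hp).symm
  | succ n ih =>
    refine ((hG v).biUnion fun u _ => ih u).subset ?_
    rintro w ⟨p, hp⟩
    cases p with
    | nil => simp at hp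
    | cons h p => exact Set.mem_biUnion h ⟨p, by simpa using hp⟩

lemma exists_finset_fixator_subset {U : Set (G ≃g G)} (hU : IsOpen U) (h1 : 1 ∈ U) :
    ∃ F : Finset V, ∀ g : G ≃g G, (∀ v ∈ F, g v = v) → g ∈ U := by
  let _ : TopologicalSpace V := ⊥
  obtain ⟨W, hW, rfl⟩ := isOpen_induced_iff.mp hU
  obtain ⟨F, u, hu, hsub⟩ := isOpen_pi_iff.mp hW _ h1
  refine ⟨F, fun g hg => hsub fun v hv => ?_⟩
  show g v ∈ u v
  rw [hg v hv]
  exact (hu v hv).2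

/-- In a connected, locally finite graph, a discrete group of automorphisms has finite vertex
stabilizers. -/
lemma finite_stabilizer_of_discrete (hG : ∀ v, (G.neighborSet v).Finite) (hc : G.Connected)
    (Γ : Subgroup (G ≃g G)) [DiscreteTopology Γ] (v : V) : Finite (stabilizer Γ v) := by
  obtain ⟨U, hU, hUΓ⟩ := isOpen_induced_iff.mp (isOpen_discrete ({1} : Set Γ))
  have h1 : (1 : Γ) ∈ Subtype.val ⁻¹' U := by
    rw [hUΓ]
    rfl
  obtain ⟨F, hF⟩ := exists_finset_fixator_subset hU h1
  -- A stabilizing element maps a walk from `v` to `f` to a walk of the same length from `v`.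
  have hfin (f : V) : ∃ s : Set V, s.Finite ∧ ∀ γ : stabilizer Γ v, γ.1.1 f ∈ s := by
    obtain ⟨p⟩ := hc.preconnected v f
    refine ⟨_, finite_setOf_walk hG p.length v, fun γ => ?_⟩
    have hv : γ.1.1 v = v := γ.2
    exact ⟨(p.map γ.1.1.toHom).copy hv rfl, by simp⟩
  choose s hs hγ using hfin
  have (f : V) : Finite (s f) := (hs f).to_subtype
  -- Two elements that agree on `F` differ by an element of `Γ` fixing `F` pointwise, which is
  -- trivial by the choice of `F`.
  refine Finite.of_injective (fun (γ : stabilizer Γ v) (f : F) => (⟨γ.1.1 f, hγ f γ⟩ : s f)) ?_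
  intro γ δ h
  have hmem : (δ.1⁻¹ * γ.1 : Γ) ∈ Subtype.val ⁻¹' U := by
    refine hF _ fun f hf => ?_
    have hf' : γ.1.1 f = δ.1.1 f := congrArg Subtype.val (congrFun h ⟨f, hf⟩)
    show δ.1.1⁻¹ (γ.1.1 f) = f
    rw [hf']
    exact RelIso.inv_apply_self _ _
  rw [hUΓ, Set.mem_singleton_iff, inv_mul_eq_one] at hmem
  exact Subtype.ext hmem.symm

/-- A subgroup with compact factor space of the automorphism group of a vertex-transitive graph has
finitely many orbits on the vertices. -/
lemma finite_orbits_of_cocompact (ht : IsVertexTransitive G) (Γ : Subgroup (G ≃g G))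
    [CompactSpace ((G ≃g G) ⧸ Γ)] : Finite (orbitRel.Quotient Γ V) := by
  cases isEmpty_or_nonempty V with
  | inl _ => exact Finite.of_surjective _ (Quotient.mk''_surjective (s₁ := orbitRel Γ V))
  | inr hV =>
    obtain ⟨o⟩ := hV
    -- The finite set `t` meets every orbit: if `g w = o` and `g Γ = g' Γ` with `g' v = o`, then
    -- `g'⁻¹ * g` lies in `Γ` and sends `w` to `v`.
    obtain ⟨t, ht'⟩ := isCompact_univ.elim_finite_subcover
      (fun v : V => (QuotientGroup.mk '' {g : G ≃g G | g v = o} : Set ((G ≃g G) ⧸ Γ)))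
      (fun v => QuotientGroup.isOpenMap_coe _ (isOpen_setOf_aut_apply_eq G v o)) (by
        rintro x -
        obtain ⟨g, rfl⟩ := QuotientGroup.mk_surjective x
        exact Set.mem_iUnion.mpr ⟨g⁻¹ o, g, RelIso.apply_inv_self g o, rfl⟩)
    refine Set.finite_univ_iff.mp ((t.finite_toSet.image
      (Quotient.mk'' : V → orbitRel.Quotient Γ V)).subset ?_)
    rintro ω -
    obtain ⟨w, rfl⟩ := Quotient.mk''_surjective ω
    obtain ⟨g, hg⟩ := ht w o
    obtain ⟨v, hv, g', hg', hgg'⟩ := Set.mem_iUnion₂.mp (ht' (Set.mem_univ (g : (G ≃g G) ⧸ Γ)))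
    refine ⟨v, hv, ?_⟩
    rw [QuotientGroup.eq] at hgg'
    refine Quotient.sound' ?_
    rw [orbitRel_apply]
    refine ⟨⟨g'⁻¹ * g, hgg'⟩, ?_⟩
    show g'⁻¹ (g w) = v
    rw [hg, ← show g' v = o from hg']
    exact RelIso.inv_apply_self _ _

theorem not_isCocompactLattice [Nonempty V] (hG : ∀ v, (G.neighborSet v).Finite)
    (hc : G.Connected) (ht : IsVertexTransitive G) (R : V → V → Prop)
    (hR : ∀ (g : G ≃g G) x y, R x y → R (g x) (g y))
    (hout : ∀ x, {y | R x y}.Finite) (hin : ∀ x, {y | R y x}.Finite) {a b : ℕ}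
    (ha : ∀ x, Nat.card {y // R x y} = a) (hb : ∀ x, Nat.card {y // R y x} = b) (hab : a ≠ b)
    (Γ : Subgroup (G ≃g G)) : ¬ IsCocompactLattice Γ := by
  rintro ⟨_, _, _⟩
  have := finite_orbits_of_cocompact ht Γ
  exact hab (card_out_eq_card_in (Γ := Γ) (finite_stabilizer_of_discrete hG hc Γ) R
    (fun γ => hR γ.1) hout hin ha hb)

/-- Left translations are automorphisms of a Cayley graph, so an invariant relation depends only on
`h⁻¹ * k`. Inversion therefore exchanges the out-set and the in-set of the identity. -/
theorem isEmpty_iso_mulCayley [Nonempty V] (R : V → V → Prop)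
    (hR : ∀ (g : G ≃g G) x y, R x y → R (g x) (g y)) {a b : ℕ}
    (ha : ∀ x, Nat.card {y // R x y} = a) (hb : ∀ x, Nat.card {y // R y x} = b) (hab : a ≠ b)
    {H : Type*} [Group H] (S : Set H) : IsEmpty (G ≃g SimpleGraph.mulCayley S) := by
  refine ⟨fun e => hab ?_⟩
  have hmul (h : H) : ∃ g : G ≃g G, ∀ k, g (e.symm k) = e.symm (h * k) := by
    let m : SimpleGraph.mulCayley S ≃g SimpleGraph.mulCayley S :=
      { Equiv.mulLeft h with
        map_rel_iff' := by
          intro u v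
          simp [SimpleGraph.mulCayley_adj, mul_assoc] }
    exact ⟨(e.trans m).trans e.symm, fun k => by
      show e.symm (m (e (e.symm k))) = _
      rw [e.apply_symm_apply]
      rfl⟩
  rw [← ha (e.symm 1), ← hb (e.symm 1)]
  have h1 : Nat.card {y // R (e.symm 1) y} = Nat.card {k // R (e.symm 1) (e.symm k)} :=
    Nat.card_congr (Equiv.subtypeEquiv e.toEquiv fun y => by simp)
  have h2 : Nat.card {y // R y (e.symm 1)} = Nat.card {k // R (e.symm k) (e.symm 1)} :=
    Nat.card_congr (Equiv.subtypeEquiv e.toEquiv fun y => by simp)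
  rw [h1, h2]
  refine Nat.card_congr (Equiv.subtypeEquiv (Equiv.inv H) fun k => ⟨fun h => ?_, fun h => ?_⟩)
  · obtain ⟨g, hg⟩ := hmul k⁻¹
    simpa [hg] using hR g _ _ h
  · obtain ⟨g, hg⟩ := hmul k
    simpa [hg] using hR g _ _ h

end Lattice

/-- The vertices of `DL(q_1, …, q_d)`. -/
abbrev DLVertex {d : ℕ} (q : Fin d → ℕ) : Type :=
  HorocyclicVertex (fun j => HomTree (q j)) (fun _ => HomTree.hor)

/-! ### Edges as elementary moves. -/

namespace DiestelLeader

open Function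

variable {d : ℕ} {q : Fin d → ℕ}

lemma sum_level (x : DLVertex q) : ∑ k, (x.1 k).level = 0 := x.2

lemma sum_level_sub (x y : DLVertex q) : ∑ k, ((y.1 k).level - (x.1 k).level) = 0 := by
  rw [Finset.sum_sub_distrib, sum_level, sum_level, sub_zero]

lemma level_eq_of_forall_ne {x y : DLVertex q} {j : Fin d} (h : ∀ k, k ≠ j → x.1 k = y.1 k) :
    (x.1 j).level = (y.1 j).level := by
  have := sum_level_sub x y
  rw [Fintype.sum_eq_single j (fun k hk => by rw [h k hk, sub_self])] at this
  omega

/-- `Step i j x y` means that `y` is obtained from `x` by moving the `i`-th coordinate to its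
predecessor and the `j`-th coordinate to one of its successors. -/
structure Step (i j : Fin d) (x y : DLVertex q) : Prop where
  ne : i ≠ j
  up : y.1 i = (x.1 i).pred
  down : x.1 j = (y.1 j).pred
  rest : ∀ k, k ≠ i → k ≠ j → y.1 k = x.1 k

lemma Step.reverse {i j : Fin d} {x y : DLVertex q} (h : Step i j x y) : Step j i y x :=
  ⟨h.ne.symm, h.down, h.up, fun k hj hi => (h.rest k hi hj).symm⟩

lemma Step.level_up {i j : Fin d} {x y : DLVertex q} (h : Step i j x y) :
    (y.1 i).level = (x.1 i).level - 1 := congrArg HomTree.level h.up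

lemma Step.level_down {i j : Fin d} {x y : DLVertex q} (h : Step i j x y) :
    (y.1 j).level = (x.1 j).level + 1 := by
  have : (x.1 j).level = (y.1 j).level - 1 := congrArg HomTree.level h.down
  omega

/-- Two moves in the same vertical direction would change the sum of the levels by `±2`. -/
lemma adj_iff {x y : DLVertex q} : (diestelLeader q).Adj x y ↔ ∃ i j, Step i j x y := by
  constructor
  · rintro ⟨i, j, hij, hi, hj, h⟩
    have hs := sum_level_sub x y
    rw [Fintype.sum_eq_add i j hij (fun k hk => by rw [h k hk.1 hk.2, sub_self])] at hs
    rcases hi with hi | hi <;> rcases hj with hj | hj <;>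
      have hi' := congrArg HomTree.level hi <;> have hj' := congrArg HomTree.level hj <;>
      rw [HomTree.level_pred] at hi' hj'
    · omega
    · exact ⟨i, j, hij, hi, hj, fun k h1 h2 => (h k h1 h2).symm⟩
    · exact ⟨j, i, hij.symm, hj, hi, fun k h1 h2 => (h k h2 h1).symm⟩
    · omega
  · rintro ⟨i, j, h⟩
    exact ⟨i, j, h.ne, Or.inl h.up, Or.inr h.down, fun k h1 h2 => (h.rest k h1 h2).symm⟩

lemma Step.adj {i j : Fin d} {x y : DLVertex q} (h : Step i j x y) : (diestelLeader q).Adj x y :=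
  adj_iff.mpr ⟨i, j, h⟩

lemma Step.up_ne {i j : Fin d} {x y : DLVertex q} (h : Step i j x y) : y.1 i ≠ x.1 i := fun e => by
  have := h.level_up
  rw [e] at this
  omega

lemma Step.down_ne {i j : Fin d} {x y : DLVertex q} (h : Step i j x y) : y.1 j ≠ x.1 j :=
  h.reverse.up_ne.symm

/-- The coordinates of the neighbour of `x` in direction `(i, j)` along the edge with label `a`. -/
def stepFun (x : DLVertex q) (i j : Fin d) (a : ZMod (q j)) : ∀ k, HomTree (q k) :=
  update (update x.1 i (x.1 i).pred) j ((x.1 j).succ a)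

lemma Step.eq_stepFun {i j : Fin d} {x y : DLVertex q} (h : Step i j x y) :
    ∃ a, y.1 = stepFun x i j a := by
  refine ⟨(y.1 j).label ((y.1 j).level - 1), ?_⟩
  funext k
  rw [stepFun]
  by_cases hj : k = j
  · subst hj
    rw [update_self, h.down, HomTree.succ_pred]
  · rw [update_of_ne hj]
    by_cases hi : k = i
    · subst hi
      rw [update_self, h.up]
    · rw [update_of_ne hi, h.rest k hi hj]

lemma exists_step (x : DLVertex q) {i j : Fin d} (hij : i ≠ j) (a : ZMod (q j)) :
    ∃ y : DLVertex q, y.1 = stepFun x i j a ∧ Step i j x y := by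
  have h0 : ∑ k, (stepFun x i j a k).level = 0 := by
    have : ∑ k, ((stepFun x i j a k).level - (x.1 k).level) = 0 := by
      rw [Fintype.sum_eq_add i j hij]
      · simp [stepFun, hij, HomTree.pred, HomTree.succ]
      · rintro k ⟨hi, hj⟩
        simp [stepFun, hi, hj]
    rwa [Finset.sum_sub_distrib, sum_level, sub_zero] at this
  refine ⟨⟨stepFun x i j a, h0⟩, rfl, hij, ?_, ?_, ?_⟩
  · simp [stepFun, hij]
  · simp [stepFun, HomTree.pred_succ]
  · intro k hi hj
    simp [stepFun, hi, hj]

lemma finite_neighborSet (hq : ∀ j, 2 ≤ q j) (x : DLVertex q) :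
    ((diestelLeader q).neighborSet x).Finite := by
  have (j : Fin d) : NeZero (q j) := ⟨by have := hq j; omega⟩
  refine Set.Finite.of_finite_image ((Set.finite_range
    (fun p : (_ : Fin d) × (j : Fin d) × ZMod (q j) => stepFun x p.1 p.2.1 p.2.2)).subset ?_)
    Subtype.val_injective.injOn
  rintro _ ⟨y, hy, rfl⟩
  obtain ⟨i, j, h⟩ := adj_iff.mp hy
  obtain ⟨a, ha⟩ := h.eq_stepFun
  exact ⟨⟨i, j, a⟩, ha.symm⟩

/-! ### Connectedness -/

lemma exists_ne_of_exists_ne (hne : ∃ i j, q i ≠ q j) (j : Fin d) : ∃ k, k ≠ j := by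
  obtain ⟨a, b, hab⟩ := hne
  by_cases h : a = j
  · exact ⟨b, fun hb => hab (by rw [h, hb])⟩
  · exact ⟨a, h⟩

/-- Raise coordinate `j` of both vertices while coordinate `k` descends along label `0` in both;
after `n` moves the two vertices coincide. -/
lemma reachable_of_iterate_pred_eq {j k : Fin d} (hjk : j ≠ k) (n : ℕ) (x y : DLVertex q)
    (h : ∀ l, l ≠ j → x.1 l = y.1 l) (hn : HomTree.pred^[n] (x.1 j) = HomTree.pred^[n] (y.1 j)) :
    (diestelLeader q).Reachable x y := by
  induction n generalizing x y with
  | zero =>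
    have : x = y := by
      refine Subtype.ext (funext fun l => ?_)
      by_cases hl : l = j
      · subst hl; exact hn
      · exact h l hl
    rw [this]
  | succ n ih =>
    obtain ⟨x', hx', hsx⟩ := exists_step x hjk 0
    obtain ⟨y', hy', hsy⟩ := exists_step y hjk 0
    refine hsx.adj.reachable.trans ((ih x' y' ?_ ?_).trans hsy.adj.reachable.symm)
    · intro l hl
      rw [hx', hy', stepFun, stepFun]
      by_cases hk : l = k
      · subst hk; rw [update_self, update_self, h l hl]
      · rw [update_of_ne hk, update_of_ne hk, update_of_ne hl, update_of_ne hl, h l hl]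
    · rw [hsx.up, hsy.up]
      exact hn

lemma reachable_of_forall_ne {j k : Fin d} (hjk : j ≠ k) (x y : DLVertex q)
    (h : ∀ l, l ≠ j → x.1 l = y.1 l) : (diestelLeader q).Reachable x y := by
  obtain ⟨m, n, hmn⟩ := HomTree.exists_common_ancestor (x.1 j) (y.1 j)
  have hl := congrArg HomTree.level hmn
  rw [HomTree.level_iterate, HomTree.level_iterate, level_eq_of_forall_ne h] at hl
  obtain rfl : m = n := by omega
  exact reachable_of_iterate_pred_eq hjk m x y h hmn

lemma reachable_of_level_eq (hne : ∃ i j, q i ≠ q j) (s : Finset (Fin d)) (x y : DLVertex q)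
    (hl : ∀ k, (x.1 k).level = (y.1 k).level) (h : ∀ k, k ∉ s → x.1 k = y.1 k) :
    (diestelLeader q).Reachable x y := by
  induction s using Finset.induction_on generalizing x with
  | empty =>
    have : x = y := Subtype.ext (funext fun k => h k (Finset.notMem_empty k))
    rw [this]
  | insert j s hj ih =>
    have hlev (k) : (update x.1 j (y.1 j) k).level = (x.1 k).level := by
      by_cases hk : k = j
      · subst hk; rw [update_self, hl]
      · rw [update_of_ne hk]
    let z : DLVertex q := ⟨update x.1 j (y.1 j), by
      simp only [HomTree.hor, hlev]
      exact sum_level x⟩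
    obtain ⟨k, hk⟩ := exists_ne_of_exists_ne hne j
    refine (reachable_of_forall_ne hk.symm x z fun l hl => (update_of_ne hl _ _).symm).trans
      (ih z (fun k => (hlev k).trans (hl k)) fun k hks => ?_)
    by_cases hkj : k = j
    · subst hkj; exact update_self _ _ _
    · exact (update_of_ne hkj _ _).trans (h k (by simp [hkj, hks]))

/-- The level differences sum to zero, so unless all vanish some coordinate `i` of `x` has too large
a level and some `j` too small a one. A move in direction `(i, j)` shrinks the total discrepancy. -/
lemma reachable (hne : ∃ i j, q i ≠ q j) (n : ℕ) (x y : DLVertex q)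
    (hn : ∑ k, ((x.1 k).level - (y.1 k).level).natAbs ≤ n) : (diestelLeader q).Reachable x y := by
  induction n generalizing x with
  | zero =>
    refine reachable_of_level_eq hne Finset.univ x y (fun k => ?_) (by simp)
    have := (Finset.sum_eq_zero_iff.mp (Nat.le_zero.mp hn)) k (Finset.mem_univ k)
    omega
  | succ n ih =>
    by_cases hl : ∀ k, (x.1 k).level = (y.1 k).level
    · exact reachable_of_level_eq hne Finset.univ x y hl (by simp)
    · push Not at hl
      obtain ⟨k, hk⟩ := hl
      obtain ⟨i, -, hi⟩ := Finset.exists_pos_of_sum_zero_of_exists_nonzero _ (sum_level_sub y x)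
        ⟨k, Finset.mem_univ k, by omega⟩
      obtain ⟨j, -, hj⟩ := Finset.exists_pos_of_sum_zero_of_exists_nonzero _ (sum_level_sub x y)
        ⟨k, Finset.mem_univ k, by omega⟩
      have hij : i ≠ j := by
        rintro rfl
        omega
      obtain ⟨z, -, hz⟩ := exists_step x hij 0
      refine hz.adj.reachable.trans (ih z (Nat.lt_succ_iff.mp (lt_of_lt_of_le ?_ hn)))
      have hi' := hz.level_up
      have hj' := hz.level_down
      refine Finset.sum_lt_sum (fun l _ => ?_) ⟨i, Finset.mem_univ i, by omega⟩
      by_cases hli : l = i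
      · subst hli; omega
      · by_cases hlj : l = j
        · subst hlj; omega
        · rw [hz.rest l hli hlj]

/-- The origin of `DL(q_1, …, q_d)`. -/
def origin (q : Fin d → ℕ) : DLVertex q :=
  ⟨fun j => HomTree.origin (q j), Finset.sum_eq_zero fun _ _ => rfl⟩

theorem connected (hne : ∃ i j, q i ≠ q j) : (diestelLeader q).Connected :=
  have : Nonempty (DLVertex q) := ⟨origin q⟩
  ⟨fun x y => reachable hne _ x y le_rfl⟩

end DiestelLeader

/-! ### Transitivity -/

namespace HomTree

variable {q : ℕ}

/-- The map of the tree that shifts the horocycles by `n` and translates the labels by `t`. -/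
def translate (n : ℤ) (t : ℤ → ZMod q) (ht : ∃ m, ∀ k, k < m → t k = 0) (v : HomTree q) :
    HomTree q where
  level := v.level + n
  label k := if k < v.level + n then v.label (k - n) + t k else 0
  label_eq_zero k hk := if_neg (not_lt.mpr hk)
  finite_support := by
    obtain ⟨m, hm⟩ := v.finite_support
    obtain ⟨m', hm'⟩ := ht
    refine ⟨min (m + n) m', fun k hk => ?_⟩
    rw [hm (k - n) (by omega), hm' k (by omega), add_zero, ite_self]

lemma pred_translate (n : ℤ) (t : ℤ → ZMod q) (ht : ∃ m, ∀ k, k < m → t k = 0) (v : HomTree q) :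
    (translate n t ht v).pred = translate n t ht v.pred := by
  ext k
  · simp only [pred, translate]; ring
  · show (if k < v.level + n - 1 then if k < v.level + n then v.label (k - n) + t k else 0 else 0) =
      if k < v.level - 1 + n then (if k - n < v.level - 1 then v.label (k - n) else 0) + t k else 0
    by_cases hk : k < v.level + n - 1
    · rw [if_pos hk, if_pos (by omega), if_pos (by omega), if_pos (by omega)]
    · rw [if_neg hk, if_neg (by omega)]

/-- Labels form a group, so a shift of the levels followed by adding the difference of the two label
sequences carries `x` to `y`. The difference vanishes far towards `ω`, which keeps the labels
admissible. -/
lemma exists_equiv (x y : HomTree q) : ∃ e : HomTree q ≃ HomTree q, e x = y ∧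
    (∀ v, (e v).pred = e v.pred) ∧ ∀ v, (e v).level = v.level + (y.level - x.level) := by
  obtain ⟨n, hn⟩ : ∃ n, n = y.level - x.level := ⟨_, rfl⟩
  obtain ⟨a, ha⟩ := x.finite_support
  obtain ⟨b, hb⟩ := y.finite_support
  let t (k : ℤ) : ZMod q := y.label k - x.label (k - n)
  have ht (k : ℤ) (hk : k < min (a + n) b) : t k = 0 := by
    simp only [t]
    rw [ha (k - n) (by omega), hb k (by omega), sub_zero]
  have ht' : ∃ m, ∀ k, k < m → -t (k + n) = 0 :=
    ⟨min (a + n) b - n, fun k hk => by rw [ht (k + n) (by omega), neg_zero]⟩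
  refine ⟨⟨translate n t ⟨min (a + n) b, ht⟩, translate (-n) (fun k => -t (k + n)) ht', ?_, ?_⟩,
    ?_, ?_, ?_⟩
  · intro v
    ext k
    · simp [translate]
    · by_cases hk : k < v.level
      · simp [translate, hk]
      · simp [translate, hk, v.label_eq_zero k (not_lt.mp hk)]
  · intro v
    ext k
    · simp [translate]
    · by_cases hk : k < v.level
      · simp [translate, hk]
      · simp [translate, hk, v.label_eq_zero k (not_lt.mp hk)]
  · ext k
    · simp [translate, hn]
    · have hxy : x.level + n = y.level := by omega
      by_cases hk : k < y.level
      · simp [translate, t, hxy, hk]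
      · simp [translate, hxy, hk, y.label_eq_zero k (not_lt.mp hk)]
  · exact pred_translate n t ⟨min (a + n) b, ht⟩
  · intro v
    simp [translate, hn]

end HomTree

namespace DiestelLeader

variable {d : ℕ} {q : Fin d → ℕ}

/-- Tree automorphisms are applied coordinatewise. Their level shifts are the level differences of
`x` and `y`, which sum to zero, so the product preserves the vertex set. -/
theorem isVertexTransitive (q : Fin d → ℕ) : IsVertexTransitive (diestelLeader q) := by
  intro x y
  choose e hxy hpred hlevel using fun j => HomTree.exists_equiv (x.1 j) (y.1 j)
  have hsum (v : ∀ k, HomTree (q k)) : ∑ k, HomTree.hor (e k (v k)) = ∑ k, HomTree.hor (v k) := by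
    simp only [HomTree.hor, hlevel]
    rw [Finset.sum_add_distrib, sum_level_sub, add_zero]
  have hadj (j : Fin d) (v w : HomTree (q j)) :
      (HomTree.graph (q j)).Adj (e j v) (e j w) ↔ (HomTree.graph (q j)).Adj v w := by
    simp [HomTree.graph, hpred]
  let E : DLVertex q ≃ DLVertex q :=
    (Equiv.piCongrRight e).subtypeEquiv fun v => by
      simp only [Equiv.piCongrRight_apply, Pi.map_apply, hsum]
  refine ⟨⟨E, ?_⟩, Subtype.ext (funext hxy)⟩
  intro v w
  have hE (v : DLVertex q) (k : Fin d) : (E v).1 k = e k (v.1 k) := rfl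
  simp only [diestelLeader, horocyclicProduct, hE, hadj, (e _).apply_eq_iff_eq]

end DiestelLeader

/-! ### A graph invariant of directed edges. -/

section Twins

variable {V : Type*} (G : SimpleGraph V)

/-- Distinct, non-adjacent vertices with at least `n` common neighbours. -/
def IsTwin (n : ℕ) (y z : V) : Prop :=
  y ≠ z ∧ ¬ G.Adj y z ∧ n ≤ (G.commonNeighbors y z).ncard

/-- The number of neighbours of `x` that are equal to `y` or twins of `y`. -/
noncomputable def twinCount (n : ℕ) (x y : V) : ℕ :=
  {z | G.Adj x z ∧ (z = y ∨ IsTwin G n y z)}.ncard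

variable {G}

lemma isTwin_apply_iff (g : G ≃g G) (n : ℕ) (y z : V) :
    IsTwin G n (g y) (g z) ↔ IsTwin G n y z := by
  have h : G.commonNeighbors (g y) (g z) = g '' G.commonNeighbors y z := by
    ext w
    obtain ⟨w, rfl⟩ := g.surjective w
    simp [SimpleGraph.mem_commonNeighbors, g.map_adj_iff]
  rw [IsTwin, IsTwin, h, Set.ncard_image_of_injective _ g.injective, g.map_adj_iff,
    g.injective.ne_iff]

lemma twinCount_apply (g : G ≃g G) (n : ℕ) (x y : V) :
    twinCount G n (g x) (g y) = twinCount G n x y := by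
  rw [twinCount, twinCount,
    ← Set.ncard_image_of_injective {z | G.Adj x z ∧ (z = y ∨ IsTwin G n y z)} g.injective]
  congr 1
  ext w
  obtain ⟨w, rfl⟩ := g.surjective w
  simp [g.map_adj_iff, isTwin_apply_iff]

end Twins

/-! ### Twins are siblings, and the resulting degree count. -/

namespace DiestelLeader

open Function

variable {d : ℕ} {q : Fin d → ℕ}

/-- The coordinates of a vertex. -/
abbrev coords (x : DLVertex q) : ∀ k, HomTree (q k) := x.1

lemma ncard_image_coords (s : Set (DLVertex q)) : (coords '' s).ncard = s.ncard :=
  Set.ncard_image_of_injective s Subtype.val_injective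

/-- `y` and `z` differ only in the `j`-th coordinate, where they have the same predecessor. -/
def SiblingAt (j : Fin d) (y z : DLVertex q) : Prop :=
  (∀ k, k ≠ j → y.1 k = z.1 k) ∧ (y.1 j).pred = (z.1 j).pred

lemma not_adj_of_forall_ne {j : Fin d} {y z : DLVertex q} (h : ∀ k, k ≠ j → y.1 k = z.1 k) :
    ¬ (diestelLeader q).Adj y z := by
  rw [adj_iff]
  rintro ⟨a, b, hs⟩
  by_cases ha : a = j
  · exact hs.down_ne (h b (fun hb => hs.ne (ha.trans hb.symm))).symm
  · exact hs.up_ne (h a ha).symm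

/-- Raising coordinate `j` merges the siblings. The compensating descent may use any of the `d - 1`
other coordinates, each with at least two labels. -/
lemma le_ncard_commonNeighbors (hq : ∀ j, 2 ≤ q j) {j : Fin d} {y z : DLVertex q}
    (h : SiblingAt j y z) :
    2 * (d - 1) ≤ ((diestelLeader q).commonNeighbors y z).ncard := by
  choose f hf hstep using fun p : {k // k ≠ j} × Fin 2 => exists_step y p.1.2.symm (p.2.val : ZMod _)
  have hinj : Injective f := by
    rintro p p' hpp
    have h1 : p.1 = p'.1 := by
      by_contra hne
      have h2 := (hstep p).down_ne
      rw [hpp, (hstep p').rest _ p.1.2 (fun e => hne (Subtype.ext e))] at h2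
      exact h2 rfl
    obtain ⟨k, a⟩ := p
    obtain ⟨k', b⟩ := p'
    obtain rfl : k = k' := h1
    have h2 : (f (k, a)).1 k = (f (k, b)).1 k := by rw [hpp]
    rw [hf, hf, stepFun, stepFun, update_self, update_self] at h2
    have h3 : ((a.val : ℕ) : ZMod (q k)) = ((b.val : ℕ) : ZMod (q k)) := HomTree.succ_injective _ h2
    rw [ZMod.natCast_eq_natCast_iff', Nat.mod_eq_of_lt (lt_of_lt_of_le a.2 (hq k)),
      Nat.mod_eq_of_lt (lt_of_lt_of_le b.2 (hq k))] at h3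
    rw [Fin.ext h3]
  have hcard : 2 * (d - 1) = (Set.range f).ncard := by
    rw [← Nat.card_coe_set_eq, Nat.card_range_of_injective hinj, Nat.card_prod,
      Nat.card_eq_fintype_card, Nat.card_eq_fintype_card, Fintype.card_subtype_compl,
      Fintype.card_fin, Fintype.card_fin, Fintype.card_subtype_eq, mul_comm]
  rw [hcard]
  refine Set.ncard_le_ncard ?_ ((finite_neighborSet hq y).subset Set.inter_subset_left)
  rintro _ ⟨p, rfl⟩
  rw [SimpleGraph.mem_commonNeighbors]
  have hs := hstep p
  refine ⟨hs.adj, Step.adj (i := j) (j := p.1) ⟨hs.ne, hs.up.trans h.2, ?_, ?_⟩⟩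
  · rw [← h.1 _ p.1.2, hs.down]
  · intro k h1 h2
    rw [hs.rest k h1 h2, h.1 k h1]

/-- If `w` is a common neighbour of two vertices that are neither adjacent nor siblings,
then it is obtained by moving two coordinates in which the vertices differ. -/
lemma Step.ne_of_not_siblingAt {y w z : DLVertex q} {a b a' b' : Fin d} (h : Step a b y w)
    (h' : Step a' b' w z) (hadj : ¬ (diestelLeader q).Adj y z)
    (hsib : ∀ j, ¬ SiblingAt j y z) : z.1 a ≠ y.1 a ∧ z.1 b ≠ y.1 b := by
  have hb : z.1 b ≠ y.1 b := by
    intro hb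
    -- If coordinate `b` returns to its old value, the second move must undo the descent there. The
    -- two moves then combine into a sibling pair or a single edge.
    have hba : b = a' := by
      by_contra hba
      by_cases hbb : b = b'
      · have h1 := h.level_down
        have h2 := h'.level_down
        rw [← hbb, hb] at h2
        omega
      · exact h.down_ne ((h'.rest b hba hbb).symm.trans hb)
    subst hba
    by_cases hab : b' = a
    · subst hab
      refine hsib b' ⟨fun k hk => ?_, h.up.symm.trans h'.down⟩
      by_cases hkb : k = b
      · subst hkb; exact hb.symm
      · rw [h'.rest k hkb hk, h.rest k hk hkb]
    · refine hadj (Step.adj (i := a) (j := b') ⟨Ne.symm hab, ?_, ?_, fun k h1 h2 => ?_⟩)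
      · rw [h'.rest a h.ne (Ne.symm hab), h.up]
      · rw [← h.rest b' hab h'.ne.symm, h'.down]
      · by_cases hkb : k = b
        · subst hkb; exact hb
        · rw [h'.rest k hkb h2, h.rest k h1 hkb]
  refine ⟨fun ha => ?_, hb⟩
  have hab : a = b' := by
    by_contra hab
    by_cases haa : a = a'
    · have h1 := h.level_up
      have h2 := h'.level_up
      rw [← haa, ha] at h2
      omega
    · exact h.up_ne ((h'.rest a haa hab).symm.trans ha)
  subst hab
  by_cases hba : a' = b
  · subst hba
    exact hb (h'.up.trans h.down.symm)
  · refine hadj (Step.adj (i := a') (j := b) ⟨hba, ?_, ?_, fun k h1 h2 => ?_⟩)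
    · rw [h'.up, h.rest a' h'.ne hba]
    · rw [h.down, h'.rest b (Ne.symm hba) h.ne.symm]
    · by_cases hka : k = a
      · subst hka; exact ha
      · rw [h'.rest k h1 hka, h.rest k hka h2]

/-- A common neighbour is determined by its raised coordinate in `U` and its lowered one in `W`.
These are disjoint sets of coordinates where `y` and `z` differ, and `U.card + W.card` is at most
`min 4 d`. So there are at most 1, 2, 4 common neighbours for `d = 2`, `d = 3`, `d ≥ 4`, below `2 *
(d - 1)` each time. -/
lemma ncard_commonNeighbors_lt (hd : 2 ≤ d) {y z : DLVertex q}
    (hadj : ¬ (diestelLeader q).Adj y z) (hsib : ∀ j, ¬ SiblingAt j y z) :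
    ((diestelLeader q).commonNeighbors y z).ncard < 2 * (d - 1) := by
  classical
  rcases ((diestelLeader q).commonNeighbors y z).eq_empty_or_nonempty with h0 | ⟨x, hx⟩
  · rw [h0, Set.ncard_empty]
    omega
  let D : Finset (Fin d) := Finset.univ.filter fun k => z.1 k ≠ y.1 k
  let U := D.filter fun k => (z.1 k).level ≤ (y.1 k).level
  let W := D.filter fun k => ¬ (z.1 k).level ≤ (y.1 k).level
  have hUW : U.card + W.card = D.card := Finset.card_filter_add_card_filter_not _
  have hD : D.card ≤ 4 := by
    obtain ⟨a, b, h⟩ := adj_iff.mp hx.1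
    obtain ⟨a', b', h'⟩ := adj_iff.mp (SimpleGraph.Adj.symm hx.2)
    refine (Finset.card_le_card (t := {a, b, a', b'}) fun k hk => ?_).trans Finset.card_le_four
    by_contra hk'
    simp only [Finset.mem_insert, Finset.mem_singleton, not_or] at hk'
    refine (Finset.mem_filter.mp hk).2 ?_
    rw [h'.rest k hk'.2.2.1 hk'.2.2.2, h.rest k hk'.1 hk'.2.1]
  have hD' : D.card ≤ d := (Finset.card_le_univ D).trans_eq (Fintype.card_fin d)
  -- In the lowered coordinate `z` is one or two levels beyond `y`; the common neighbour agrees with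
  -- `z` in the first case and is its predecessor in the second.
  let F (p : Fin d × Fin d) : ∀ k, HomTree (q k) := update (update y.1 p.1 (y.1 p.1).pred) p.2
    (if (z.1 p.2).level = (y.1 p.2).level + 1 then z.1 p.2 else (z.1 p.2).pred)
  have hsub : coords '' (diestelLeader q).commonNeighbors y z ⊆
      ((U ×ˢ W).image F : Finset (∀ k, HomTree (q k))) := by
    rintro _ ⟨w, hw, rfl⟩
    obtain ⟨a, b, h⟩ := adj_iff.mp hw.1
    obtain ⟨a', b', h'⟩ := adj_iff.mp (SimpleGraph.Adj.symm hw.2)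
    obtain ⟨ha, hb⟩ := h.ne_of_not_siblingAt h' hadj hsib
    have hup := h.level_up
    have hdown := h.level_down
    have haU : (z.1 a).level ≤ (y.1 a).level := by
      by_cases h1 : a = a'
      · subst h1
        have := h'.level_up
        omega
      · by_cases h2 : a = b'
        · subst h2
          have := h'.level_down
          omega
        · rw [h'.rest a h1 h2]
          omega
    have hba : b ≠ a' := by
      rintro rfl
      exact hb (h'.up.trans h.down.symm)
    have hbW : (y.1 b).level < (z.1 b).level ∧
        (if (z.1 b).level = (y.1 b).level + 1 then z.1 b else (z.1 b).pred) = w.1 b := by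
      by_cases h2 : b = b'
      · subst h2
        have := h'.level_down
        rw [if_neg (by omega), h'.down]
        exact ⟨by omega, rfl⟩
      · rw [h'.rest b hba h2, if_pos hdown]
        exact ⟨by omega, rfl⟩
    rw [Finset.mem_coe, Finset.mem_image]
    refine ⟨(a, b), Finset.mem_product.mpr ⟨?_, ?_⟩, ?_⟩
    · simp [U, D, ha, haU]
    · simp [W, D, hb, hbW.1]
    · funext k
      by_cases hkb : k = b
      · subst hkb
        simp only [F, update_self, hbW.2]
      · by_cases hka : k = a
        · subst hka
          simp only [F, update_of_ne hkb, update_self, h.up]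
        · simp only [F, update_of_ne hkb, update_of_ne hka, h.rest k hka hkb]
  have hle : ((diestelLeader q).commonNeighbors y z).ncard ≤ U.card * W.card := by
    rw [← ncard_image_coords, ← Finset.card_product]
    refine (Set.ncard_le_ncard hsub (Finset.finite_toSet _)).trans ?_
    rw [Set.ncard_coe_finset]
    exact Finset.card_image_le
  refine hle.trans_lt ?_
  have hU : U.card ≤ 4 := by omega
  generalize U.card = u at *
  generalize W.card = w at *
  interval_cases u <;> omega

lemma isTwin_iff (hq : ∀ j, 2 ≤ q j) (hd : 2 ≤ d) {y z : DLVertex q} :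
    IsTwin (diestelLeader q) (2 * (d - 1)) y z ↔ y ≠ z ∧ ∃ j, SiblingAt j y z := by
  constructor
  · rintro ⟨hne, hadj, hcard⟩
    refine ⟨hne, ?_⟩
    by_contra! hsib
    exact (ncard_commonNeighbors_lt hd hadj hsib).not_ge hcard
  · rintro ⟨hne, j, h⟩
    exact ⟨hne, not_adj_of_forall_ne h.1, le_ncard_commonNeighbors hq h⟩

lemma Step.twinCount_eq (hq : ∀ j, 2 ≤ q j) (hd : 2 ≤ d) {x y : DLVertex q} {i j : Fin d}
    (h : Step i j x y) : twinCount (diestelLeader q) (2 * (d - 1)) x y = q j := by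
  have himage : coords '' {z | (diestelLeader q).Adj x z ∧
      (z = y ∨ IsTwin (diestelLeader q) (2 * (d - 1)) y z)} = Set.range (stepFun x i j) := by
    ext f
    constructor
    · rintro ⟨z, ⟨hxz, hz⟩, rfl⟩
      have hstep : Step i j x z := by
        rcases hz with rfl | hz
        · exact h
        obtain ⟨hne, k, hsib⟩ := (isTwin_iff hq hd).mp hz
        obtain ⟨a, b, hab⟩ := adj_iff.mp hxz
        -- A sibling of `y` in another coordinate `k` still shows the descent at `j`. If `k ≠ i` it
        -- also shows the ascent at `i`, leaving no move for `k`; if `k = i`, its level forces the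
        -- same ascent. Either way it would equal `y`.
        have hkj : k = j := by
          by_contra hkj
          have hjz : z.1 j ≠ x.1 j := by
            rw [← hsib.1 j (Ne.symm hkj)]
            exact h.down_ne
          have hlev : (z.1 j).level = (x.1 j).level + 1 := by
            rw [← hsib.1 j (Ne.symm hkj), h.level_down]
          have hjb : j = b := by
            by_contra hjb
            by_cases hja : j = a
            · subst hja
              have := hab.level_up
              omega
            · exact hjz (hab.rest j hja hjb)
          have hkz : z.1 k ≠ y.1 k := fun e => hne (Subtype.ext (funext fun l => by
            by_cases hl : l = k
            · subst hl; exact e.symm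
            · exact hsib.1 l hl))
          by_cases hki : k = i
          · subst hki
            have h1 : (y.1 k).level = (z.1 k).level := level_eq_of_forall_ne hsib.1
            have h2 := h.level_up
            by_cases hka : k = a
            · subst hka
              exact hkz (hab.up.trans h.up.symm)
            · rw [hab.rest k hka (hjb ▸ hkj)] at h1
              omega
          · have hiz : z.1 i ≠ x.1 i := by
              rw [← hsib.1 i (Ne.symm hki)]
              exact h.up_ne
            have hia : i = a := by
              by_contra hia
              exact hiz (hab.rest i hia (hjb ▸ h.ne))
            refine hkz ?_
            rw [hab.rest k (hia ▸ hki) (hjb ▸ hkj), h.rest k hki hkj]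
        subst hkj
        refine ⟨h.ne, ?_, ?_, fun l h1 h2 => ?_⟩
        · rw [← hsib.1 i h.ne, h.up]
        · rw [← hsib.2, h.down]
        · rw [← hsib.1 l h2, h.rest l h1 h2]
      obtain ⟨a, ha⟩ := hstep.eq_stepFun
      exact ⟨a, ha.symm⟩
    · rintro ⟨a, rfl⟩
      obtain ⟨z, hz, hstep⟩ := exists_step x h.ne a
      refine ⟨z, ⟨hstep.adj, or_iff_not_imp_left.mpr fun hzy => ?_⟩, hz⟩
      refine (isTwin_iff hq hd).mpr ⟨Ne.symm hzy, j, fun k hk => ?_, h.down.symm.trans hstep.down⟩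
      by_cases hki : k = i
      · subst hki
        rw [h.up, hstep.up]
      · rw [h.rest k hki hk, hstep.rest k hki hk]
  have hinj : Injective (stepFun x i j) := fun a b hab => by
    have := congrFun hab j
    rw [stepFun, stepFun, update_self, update_self] at this
    exact HomTree.succ_injective _ this
  rw [twinCount, ← ncard_image_coords, himage,
    ← Nat.card_coe_set_eq, Nat.card_range_of_injective hinj, Nat.card_zmod]

lemma stepFun_level (x : DLVertex q) {i j : Fin d} (hij : i ≠ j) (a : ZMod (q j)) (k : Fin d) :
    (stepFun x i j a k).level =
      (x.1 k).level + (if k = j then 1 else 0) - (if k = i then 1 else 0) := by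
  rw [stepFun]
  by_cases hj : k = j
  · subst hj
    simp [HomTree.succ, hij.symm]
  · by_cases hi : k = i
    · subst hi
      simp [HomTree.pred, hij]
    · simp [hi, hj]

/-- The relevant edges correspond to a raised coordinate with `q i = m`, a lowered one with `q j =
n`, and one of `n` labels. Since `m ≠ n`, the two coordinates are automatically distinct. -/
lemma card_adj_twinCount (hq : ∀ j, 2 ≤ q j) (hd : 2 ≤ d) {m n : ℕ} (hmn : m ≠ n)
    (x : DLVertex q) :
    Nat.card {y // (diestelLeader q).Adj x y ∧ twinCount (diestelLeader q) (2 * (d - 1)) x y = n ∧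
      twinCount (diestelLeader q) (2 * (d - 1)) y x = m} =
    (Finset.univ.filter fun i => q i = m).card * (Finset.univ.filter fun j => q j = n).card * n := by
  classical
  have (j : Fin d) : NeZero (q j) := ⟨by have := hq j; omega⟩
  let I := Finset.univ.filter fun i => q i = m
  let J := Finset.univ.filter fun j => q j = n
  let T : Finset ((p : Fin d × Fin d) × ZMod (q p.2)) :=
    (I ×ˢ J).sigma fun _ => Finset.univ
  let F (s : (p : Fin d × Fin d) × ZMod (q p.2)) : ∀ k, HomTree (q k) := stepFun x s.1.1 s.1.2 s.2
  have hT {s} : s ∈ T ↔ q s.1.1 = m ∧ q s.1.2 = n := by simp [T, I, J]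
  have hTne {s} (hs : s ∈ T) : s.1.1 ≠ s.1.2 := fun e =>
    hmn ((hT.mp hs).1.symm.trans ((congrArg q e).trans (hT.mp hs).2))
  have hinj : Set.InjOn F T := by
    rintro ⟨⟨i, j⟩, a⟩ hs ⟨⟨i', j'⟩, a'⟩ hs' h
    have hij : i ≠ j := hTne hs
    have hij' : i' ≠ j' := hTne hs'
    have hlev (k : Fin d) := congrArg HomTree.level (congrFun h k)
    simp only [F, stepFun_level x hij, stepFun_level x hij'] at hlev
    obtain rfl : j = j' := by
      have := hlev j
      by_contra hne
      simp only [if_true, if_neg hij.symm, if_neg hne] at this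
      split_ifs at this <;> omega
    obtain rfl : i = i' := by
      have := hlev i
      by_contra hne
      simp only [if_true, if_neg hij, if_neg hne] at this
      omega
    have := congrFun h j
    simp only [F, stepFun, update_self] at this
    rw [HomTree.succ_injective _ this]
  have himage : coords '' {y | (diestelLeader q).Adj x y ∧
      twinCount (diestelLeader q) (2 * (d - 1)) x y = n ∧
      twinCount (diestelLeader q) (2 * (d - 1)) y x = m} = F '' T := by
    ext f
    constructor
    · rintro ⟨y, ⟨hxy, hn, hm⟩, rfl⟩
      obtain ⟨i, j, h⟩ := adj_iff.mp hxy
      rw [h.twinCount_eq hq hd] at hn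
      rw [h.reverse.twinCount_eq hq hd] at hm
      obtain ⟨a, ha⟩ := h.eq_stepFun
      exact ⟨⟨(i, j), a⟩, hT.mpr ⟨hm, hn⟩, ha.symm⟩
    · rintro ⟨s, hs, rfl⟩
      obtain ⟨y, hy, h⟩ := exists_step x (hTne hs) s.2
      exact ⟨y, ⟨h.adj, (h.twinCount_eq hq hd).trans (hT.mp hs).2,
        (h.reverse.twinCount_eq hq hd).trans (hT.mp hs).1⟩, hy⟩
  rw [show I.card * J.card * n = T.card by
    rw [Finset.card_sigma, ← Finset.card_product, ← smul_eq_mul, ← Finset.sum_const]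
    refine Finset.sum_congr rfl fun p hp => ?_
    rw [Finset.card_univ, ZMod.card]
    exact (Finset.mem_filter.mp (Finset.mem_product.mp hp).2).2.symm]
  rw [← Set.ncard_coe_finset T, ← hinj.ncard_image, ← himage, ncard_image_coords]
  rfl

end DiestelLeader

/-! ### The main theorem. -/

theorem corollary2p8 (d : ℕ) (q : Fin d → ℕ) (hq : ∀ j, 2 ≤ q j)
    (hne : ∃ i j, q i ≠ q j) :
    (∀ Γ : Subgroup (diestelLeader q ≃g diestelLeader q), ¬ IsCocompactLattice Γ) ∧
    IsVertexTransitive (diestelLeader q) ∧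
    ∀ (G : Type*) [Group G] (S : Set G), S.Finite → (∀ s ∈ S, s⁻¹ ∈ S) →
      Subgroup.closure S = ⊤ →
      IsEmpty (diestelLeader q ≃g SimpleGraph.mulCayley S) := by
  obtain ⟨i, j, hij⟩ := hne
  have hd : 2 ≤ d := by
    by_contra hd
    exact hij (congrArg q (Fin.ext (by omega)))
  have : Nonempty (DLVertex q) := ⟨DiestelLeader.origin q⟩
  let t := twinCount (diestelLeader q) (2 * (d - 1))
  let R (x y : DLVertex q) : Prop := (diestelLeader q).Adj x y ∧ t x y = q j ∧ t y x = q i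
  have hR (g : diestelLeader q ≃g diestelLeader q) (x y : DLVertex q) (h : R x y) :
      R (g x) (g y) :=
    ⟨g.map_adj_iff.mpr h.1, (twinCount_apply g _ x y).trans h.2.1,
      (twinCount_apply g _ y x).trans h.2.2⟩
  have hfin := DiestelLeader.finite_neighborSet hq
  have hout := DiestelLeader.card_adj_twinCount hq hd hij
  -- Reversing the edges turns `R` into the same kind of relation with `i` and `j` exchanged.
  have hin (x : DLVertex q) :
      Nat.card {y // R y x} = _ * _ * q i :=
    (Nat.card_congr (Equiv.subtypeEquivRight fun y => by
      simp only [R, t, SimpleGraph.adj_comm _ y x, and_comm (a := twinCount _ _ y x = _)])).trans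
      (DiestelLeader.card_adj_twinCount hq hd hij.symm x)
  have hab : (Finset.univ.filter fun k => q k = q i).card *
      (Finset.univ.filter fun k => q k = q j).card * q j ≠
      (Finset.univ.filter fun k => q k = q j).card *
      (Finset.univ.filter fun k => q k = q i).card * q i := by
    rw [mul_comm (Finset.univ.filter fun k => q k = q j).card]
    have h (l : Fin d) : (Finset.univ.filter fun k => q k = q l).card ≠ 0 :=
      Finset.card_ne_zero_of_mem (a := l) (by simp)
    exact fun e => hij (Nat.eq_of_mul_eq_mul_left
      (Nat.pos_of_ne_zero (mul_ne_zero (h i) (h j))) e).symm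
  have ht := DiestelLeader.isVertexTransitive q
  refine ⟨not_isCocompactLattice hfin (DiestelLeader.connected ⟨i, j, hij⟩) ht R hR
    (fun x => (hfin x).subset fun y h => h.1) (fun x => (hfin x).subset fun y h => h.1.symm)
    hout hin hab, ht, ?_⟩
  intro G _ S _ _ _
  exact isEmpty_iso_mulCayley R hR hout hin hab S
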